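/- For real $\nu$ and $x>0$ let $J_\nu$ and $Y_\nu$ be the Bessel functions of the first and second kind, $$J_\nu(x)=\sum_{k=0}^\infty \frac{(-1)^k}{k!\,\Gamma(\nu+k+1)}\Big(\frac x2\Big)^{2k+\nu},\qquad Y_\nu(x)=\frac{\cos(\nu\pi)J_\nu(x)-J_{-\nu}(x)}{\sin(\nu\pi)}$$ (for integral $\nu$ the second quotient is replaced by its limit as the order tends to $\nu$). For a fixed $\alpha\in[0,\pi)$ let $C_\nu=\cos\alpha\, J_\nu-\sin\alpha\, Y_\nu$, and for integers $n\ge 0$ and real $\lambda>0$ let $$R_{n,\lambda}(x)=\sum_{k=0}^{\lfloor n/2\rfloor}(-1)^k\binom{n-k}{k}\frac{\Gamma(\lambda+n-k)}{\Gamma(\lambda+k)}\Big(\frac x2\Big)^{2k-n}$$ be the Lommel polynomials. Let $\nu>0$, let $m\ge 1$ be an integer, and suppose that $C_\nu$ and $C_{\nu+m}$ have no common positive zero. Then the positive zeros of $C_\nu$ form an infinite sequence $c_{\nu,1}<c_{\nu,2}<\cdots$, the union of the set of positive zeros of $C_{\nu+m}$ and the set of positive zeros of $R_{m-1,\nu+1}$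 (that is, the set of positive zeros of $R_{m-1,\nu+1}C_{\nu+m}$) forms an infinite sequence $\tau_{m,\nu,1}<\tau_{m,\nu,2}<\cdots$, both listed completely in ascending order, and $$0<c_{\nu,1}<\tau_{m,\nu,1}<c_{\nu,2}<\tau_{m,\nu,2}<\cdots .$$ -/

import Mathlib

noncomputable section

namespace BesselInterlacing

/-- The Bessel function of the first kind `J_ν(x)` of real order `ν`, for `x > 0`.
(`Real.Gamma` is `0` at the poles of `Γ`, so that `1 / Γ` is `0` there, as usual.) -/
def besselJ (ν x : ℝ) : ℝ :=
  ∑' k : ℕ, (-1 : ℝ) ^ k / ((k.factorial : ℝ) * Real.Gamma (ν + k + 1)) *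
    (x / 2) ^ (2 * (k : ℝ) + ν)

/-- The quotient `(cos(νπ) J_ν(x) - J_{-ν}(x)) / sin(νπ)`, which is `Y_ν(x)` for non-integral
`ν`. -/
def besselYQuot (ν x : ℝ) : ℝ :=
  (Real.cos (ν * Real.pi) * besselJ ν x - besselJ (-ν) x) / Real.sin (ν * Real.pi)

open Classical in
/-- The Bessel function of the second kind `Y_ν(x)` of real order `ν`, for `x > 0`: for integral
`ν` the defining quotient is replaced by its limit as the order tends to `ν`. -/
def besselY (ν x : ℝ) : ℝ :=
  if ∃ n : ℤ, ν = n then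
    Filter.limUnder (nhdsWithin ν {ν}ᶜ) (fun μ : ℝ => besselYQuot μ x)
  else besselYQuot ν x

/-- The cylinder function `C_ν^α = cos α · J_ν - sin α · Y_ν`. -/
def cylinderC (α ν x : ℝ) : ℝ :=
  Real.cos α * besselJ ν x - Real.sin α * besselY ν x

/-- The Lommel polynomial `R_{n,ν}` (a polynomial in `1 / x`), for `n ≥ 0` and `ν > 0`. -/
def lommelR (n : ℕ) (ν x : ℝ) : ℝ :=
  ∑ k ∈ Finset.range (n / 2 + 1),
    (-1 : ℝ) ^ k * ((n - k).choose k : ℝ) *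
      (Real.Gamma (ν + n - k) / Real.Gamma (ν + k)) * (x / 2) ^ (2 * (k : ℤ) - (n : ℤ))

/-- The set of positive zeros of a function. -/
def positiveZeros (f : ℝ → ℝ) : Set ℝ := {x | 0 < x ∧ f x = 0}

/-- The set `M_{m,ν}` of the positive zeros common to `C_ν` and `C_{ν+m}`. -/
def commonZeros (α : ℝ) (m : ℕ) (ν : ℝ) : Set ℝ :=
  {x | x ∈ positiveZeros (cylinderC α ν) ∧ cylinderC α (ν + m) x = 0}

/-- `u 0 < u 1 < u 2 < ⋯` is the list of all the elements of `s` in ascending order; such a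
sequence `u` is determined by `s`. -/
def IsAscendingEnumeration (s : Set ℝ) (u : ℕ → ℝ) : Prop :=
  StrictMono u ∧ Set.range u = s

end BesselInterlacing

end

namespace BesselInterlacing

open Filter Topology Set

/-! ### Lommel polynomials -/

/-! Put `g = C_ν`, `f = R_{n,ν+1} C_{ν+n+1}` with `n = m - 1`. Lommel's relation `C_{ν+n+1} =
R_{n,ν+1} C_{ν+1} - R_{n-1,ν+2} C_ν` and the ladder rules for derivatives fix two signs. At a zero
of `g`, `g' f = -(R_{n,ν+1} C_{ν+1})²`, which is negative because there is no common zero. At a zero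
of `f` where `g ≠ 0`, `g f' > 0`: if `C_{ν+n+1} = 0`, the inverse relation gives `g f' = C_ν²`; if
`R_{n,ν+1} = 0`, then `g f' = -R_{n-1,ν+2} R_{n,ν+1}' C_ν²`, positive by a Wronskian inequality for
Lommel polynomials (`lommelPrev_mul_deriv_neg`). So `f` has opposite signs at consecutive zeros of
`g` and crosses zero between them in one direction only, hence exactly once
(`existsUnique_zero_between`). It has no zero up to `c 0`, because positivity of `C_ν` near the
origin propagates to higher orders. All this uses only the ladder relations and positivity near `0`
(`IsCylinderFamily`). For actual Bessel functions these come from power series in `1/Γ` and, at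
integer orders, in its derivative. -/

theorem lommelR_zero {l : ℝ} (hl : 0 < l) (x : ℝ) : lommelR 0 l x = 1 := by
  have := (Real.Gamma_pos_of_pos hl).ne'
  simp [lommelR, this]

theorem lommelR_one {l : ℝ} (hl : 0 < l) (x : ℝ) : lommelR 1 l x = 2 * l / x := by
  have := (Real.Gamma_pos_of_pos hl).ne'
  simp only [lommelR]
  norm_num
  rw [Real.Gamma_add_one hl.ne', mul_div_assoc, div_self this]
  ring

theorem lommelR_eq_sum_range {n N : ℕ} (h : n / 2 + 1 ≤ N) (l x : ℝ) :
    lommelR n l x = ∑ k ∈ Finset.range N, (-1 : ℝ) ^ k * ((n - k).choose k : ℝ) *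
      (Real.Gamma (l + n - k) / Real.Gamma (l + k)) * (x / 2) ^ (2 * (k : ℤ) - (n : ℤ)) := by
  refine Finset.sum_subset (by simpa using h) fun k _ hk => ?_
  have hk' : n / 2 + 1 ≤ k := by simpa using hk
  rw [Nat.choose_eq_zero_of_lt (by omega : n - k < k)]
  simp

/-- Coefficients of equal powers of `x / 2` are compared. Pascal's rule and the absorption identity
combine into `key`; the lowest power, absent from the last sum, is treated separately. -/
theorem lommelR_add_two (n : ℕ) {l x : ℝ} (hl : 0 < l) (hx : 0 < x) :
    lommelR (n + 2) l x = 2 * l / x * lommelR (n + 1) (l + 1) x - lommelR n (l + 2) x := by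
  rw [lommelR_eq_sum_range (N := n / 2 + 1 + 1) (by omega) l x,
    lommelR_eq_sum_range (n := n + 1) (N := n / 2 + 1 + 1) (by omega) (l + 1) x,
    lommelR_eq_sum_range (n := n) (N := n / 2 + 1) (by omega) (l + 2) x,
    Finset.sum_range_succ' _ (n / 2 + 1), Finset.sum_range_succ' _ (n / 2 + 1), mul_add]
  refine Eq.trans ?_ (add_sub_right_comm _ _ _).symm
  have hy : (x / 2) ≠ 0 := by positivity
  have hxy : 2 * l / x = l * (x / 2)⁻¹ := by field_simp
  congr 1
  · rw [Finset.mul_sum, ← Finset.sum_sub_distrib]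
    refine Finset.sum_congr rfl fun k hk => ?_
    have hkn : k ≤ n := by
      have := Finset.mem_range.1 hk
      omega
    obtain ⟨j, rfl⟩ := Nat.exists_eq_add_of_le hkn
    have e1 : k + j + 2 - (k + 1) = j + 1 := by omega
    have e2 : k + j + 1 - (k + 1) = j := by omega
    have e3 : k + j - k = j := by omega
    rw [e1, e2, e3]
    push_cast
    have g1 : l + (k + j + 2) - (k + 1) = l + j + 1 := by ring
    have g2 : l + 1 + (k + j + 1) - (k + 1) = l + j + 1 := by ring
    have g3 : l + 2 + (k + j) - (k : ℝ) = l + j + 1 + 1 := by ring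
    have g4 : l + 1 + (k + 1 : ℝ) = l + k + 1 + 1 := by ring
    have g5 : l + 2 + (k : ℝ) = l + k + 1 + 1 := by ring
    have g6 : l + (k + 1 : ℝ) = l + k + 1 := by ring
    have z1 : (x / 2) ^ (2 * ((k : ℤ) + 1) - (k + j + 2)) = (x / 2) ^ (2 * (k : ℤ) - (k + j)) := by
      congr 1; ring
    have z2 : (x / 2) ^ (2 * ((k : ℤ) + 1) - (k + j + 1)) =
        (x / 2) ^ (2 * (k : ℤ) - (k + j)) * (x / 2) := by
      rw [← zpow_add_one₀ hy]; congr 1; ring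
    rw [g1, g2, g3, g4, g5, g6, z1, z2, hxy]
    have hk1 : l + k + 1 ≠ 0 := by positivity
    have hj1 : l + j + 1 ≠ 0 := by positivity
    rw [Real.Gamma_add_one hk1, Real.Gamma_add_one hj1]
    have hG := (Real.Gamma_pos_of_pos (by positivity : 0 < l + k + 1)).ne'
    have hch : ((j + 1).choose (k + 1) : ℝ) * (k + 1) = (j + 1) * (j.choose k : ℝ) := by
      have := Nat.add_one_mul_choose_eq j k
      exact_mod_cast this.symm
    have hpas : ((j + 1).choose (k + 1) : ℝ) = (j.choose k : ℝ) + (j.choose (k + 1) : ℝ) := by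
      exact_mod_cast Nat.choose_succ_succ j k
    have key : (l + k + 1) * ((j + 1).choose (k + 1) : ℝ) =
        l * (j.choose (k + 1) : ℝ) + (l + j + 1) * (j.choose k : ℝ) := by
      linear_combination l * hpas + hch
    field_simp
    rw [pow_succ]
    linear_combination (-(-1) ^ k) * key
  · have g1 : l + 1 + ((n : ℝ) + 1) = l + (n + 2) := by ring
    have z1 : (x / 2) ^ (-(n : ℤ) - 2) = (x / 2) ^ (-(n : ℤ) - 1) * (x / 2)⁻¹ := by
      rw [← zpow_sub_one₀ hy]; congr 1; ring
    have hG := (Real.Gamma_pos_of_pos hl).ne'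
    have e1 : 2 * ((0 : ℕ) : ℤ) - ((n + 2 : ℕ) : ℤ) = -(n : ℤ) - 2 := by push_cast; ring
    have e2 : 2 * ((0 : ℕ) : ℤ) - ((n + 1 : ℕ) : ℤ) = -(n : ℤ) - 1 := by push_cast; ring
    rw [e1, e2, z1, hxy]
    push_cast
    simp only [sub_zero, add_zero, Nat.choose_zero_right, Nat.cast_one, pow_zero, one_mul]
    rw [g1, Real.Gamma_add_one hl.ne']
    field_simp

theorem differentiableAt_lommelR (n : ℕ) (l : ℝ) {x : ℝ} (hx : 0 < x) :
    DifferentiableAt ℝ (lommelR n l) x := by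
  unfold lommelR
  refine DifferentiableAt.fun_sum fun k _ => ?_
  refine DifferentiableAt.const_mul ?_ _
  exact DifferentiableAt.zpow (f := fun y : ℝ => y / 2) (by fun_prop) (Or.inl (by positivity))

/-- `R_{n-1,l+1}`, with the convention `R_{-1,l+1} = 0`. -/
noncomputable def lommelPrev : ℕ → ℝ → ℝ → ℝ
  | 0, _, _ => 0
  | n + 1, l, x => lommelR n (l + 1) x

theorem lommelR_succ (n : ℕ) {l x : ℝ} (hl : 0 < l) (hx : 0 < x) :
    lommelR (n + 1) l x = 2 * l / x * lommelR n (l + 1) x - lommelPrev n (l + 1) x := by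
  cases n with
  | zero =>
    rw [lommelR_one hl, lommelR_zero (by positivity)]
    simp [lommelPrev]
  | succ n =>
    rw [lommelR_add_two n hl hx, lommelPrev]
    congr 2
    ring

theorem differentiableAt_lommelPrev (n : ℕ) (l : ℝ) {x : ℝ} (hx : 0 < x) :
    DifferentiableAt ℝ (lommelPrev n l) x := by
  cases n with
  | zero => exact differentiableAt_const 0
  | succ n => exact differentiableAt_lommelR n (l + 1) hx

/-- Differentiating the recurrence reproduces the same Wronskian one degree lower; the only new term
comes from the derivative of `2 * l / x`. -/
theorem lommel_wronskian_succ (n : ℕ) {l x : ℝ} (hl : 0 < l) (hx : 0 < x) :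
    lommelR n (l + 1) x * deriv (lommelR (n + 1) l) x -
        deriv (lommelR n (l + 1)) x * lommelR (n + 1) l x =
      -(2 * l / x ^ 2 * lommelR n (l + 1) x ^ 2) +
        (lommelPrev n (l + 1) x * deriv (lommelR n (l + 1)) x -
          deriv (lommelPrev n (l + 1)) x * lommelR n (l + 1) x) := by
  have hev : lommelR (n + 1) l =ᶠ[𝓝 x]
      fun y => 2 * l / y * lommelR n (l + 1) y - lommelPrev n (l + 1) y := by
    filter_upwards [lt_mem_nhds hx] with y hy using lommelR_succ n hl hy
  have hd : HasDerivAt (fun y => 2 * l / y * lommelR n (l + 1) y - lommelPrev n (l + 1) y)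
      ((0 * x - 2 * l * 1) / x ^ 2 * lommelR n (l + 1) x +
        2 * l / x * deriv (lommelR n (l + 1)) x - deriv (lommelPrev n (l + 1)) x) x :=
    (((hasDerivAt_const x (2 * l)).fun_div (hasDerivAt_id' x) hx.ne').mul
      (differentiableAt_lommelR n (l + 1) hx).hasDerivAt).sub
      (differentiableAt_lommelPrev n (l + 1) hx).hasDerivAt
  rw [hev.deriv_eq, hd.deriv, lommelR_succ n hl hx]
  ring

/-- Unrolled, the Wronskian is minus a sum of weighted squares; the last of them comes from `R_0 =
1`, which makes the sign strict. -/
theorem lommel_wronskian_neg (n : ℕ) {l x : ℝ} (hl : 0 < l) (hx : 0 < x) :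
    lommelR n (l + 1) x * deriv (lommelR (n + 1) l) x -
        deriv (lommelR n (l + 1)) x * lommelR (n + 1) l x < 0 := by
  rw [lommel_wronskian_succ n hl hx]
  induction n generalizing l with
  | zero =>
    have h0 : deriv (lommelPrev 0 (l + 1)) x = 0 := by
      have : lommelPrev 0 (l + 1) = fun _ => (0 : ℝ) := rfl
      rw [this, deriv_const]
    rw [lommelR_zero (by positivity), h0]
    simp only [lommelPrev]
    have : 0 < 2 * l / x ^ 2 := by positivity
    linarith
  | succ n ih =>
    have h1 := ih (l := l + 1) (by positivity)
    rw [← lommel_wronskian_succ n (by positivity) hx] at h1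
    have h2 : 0 ≤ 2 * l / x ^ 2 * lommelR (n + 1) (l + 1) x ^ 2 := by positivity
    have h3 : lommelPrev (n + 1) (l + 1) = lommelR n (l + 1 + 1) := rfl
    rw [h3]
    linarith

theorem lommelPrev_mul_deriv_neg (n : ℕ) {l x : ℝ} (hl : 0 < l) (hx : 0 < x)
    (h : lommelR n l x = 0) : lommelPrev n l x * deriv (lommelR n l) x < 0 := by
  cases n with
  | zero => rw [lommelR_zero hl] at h; exact absurd h one_ne_zero
  | succ n =>
    have := lommel_wronskian_neg n hl hx
    rw [h] at this
    simpa [lommelPrev] using this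

/-! ### Cylinder families -/

/-- A family of functions indexed by the order, satisfying the ladder relations of the Bessel
functions for positive orders and positive near the origin. -/
structure IsCylinderFamily (C : ℝ → ℝ → ℝ) : Prop where
  hasDerivAt_up : ∀ {ν x : ℝ}, 0 < ν → 0 < x →
    HasDerivAt (C ν) (ν / x * C ν x - C (ν + 1) x) x
  hasDerivAt_down : ∀ {ν x : ℝ}, 0 < ν → 0 < x →
    HasDerivAt (C (ν + 1)) (C ν x - (ν + 1) / x * C (ν + 1) x) x
  eventually_pos : ∀ {ν : ℝ}, 0 < ν → ∀ᶠ x in 𝓝[>] (0 : ℝ), 0 < C ν x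

namespace IsCylinderFamily

variable {C : ℝ → ℝ → ℝ} (hC : IsCylinderFamily C) {ν x b : ℝ}

include hC

theorem exists_pos (hν : 0 < ν) (hb : 0 < b) : ∃ a, 0 < a ∧ a < b ∧ 0 < C ν a := by
  have h := (hC.eventually_pos hν).and (Ioo_mem_nhdsGT hb)
  obtain ⟨a, h1, h2⟩ := h.exists
  exact ⟨a, h2.1, h2.2, h1⟩

theorem continuousOn (hν : 0 < ν) : ContinuousOn (C ν) (Ioi 0) := fun _ hx =>
  (hC.hasDerivAt_up hν hx).continuousAt.continuousWithinAt

theorem recurrence (hν : 0 < ν) (hx : 0 < x) :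
    C ν x = 2 * (ν + 1) / x * C (ν + 1) x - C (ν + 1 + 1) x := by
  have h1 := hC.hasDerivAt_up (ν := ν + 1) (by positivity) hx
  have h2 := (hC.hasDerivAt_down hν hx).unique h1
  linear_combination h2

theorem eq_lommel_mul_sub (n : ℕ) (hν : 0 < ν) (hx : 0 < x) :
    C (ν + n + 1) x =
      lommelR n (ν + 1) x * C (ν + 1) x - lommelPrev n (ν + 1) x * C ν x := by
  induction n generalizing ν with
  | zero => simp [lommelR_zero (by positivity : 0 < ν + 1), lommelPrev]
  | succ n ih =>
    have h1 := ih (ν := ν + 1) (by positivity)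
    have e : ν + ((n + 1 : ℕ) : ℝ) + 1 = ν + 1 + n + 1 := by push_cast; ring
    rw [e, h1, lommelR_succ n (by positivity) hx, hC.recurrence hν hx, lommelPrev]
    ring

/-- Inverse of Lommel's relation, for use at zeros of `C (ν + n + 1)`, where `S` is irrelevant. The
second equation only carries the induction. -/
theorem exists_eq_lommel_mul_add (n : ℕ) (hν : 0 < ν) (hx : 0 < x) : ∃ S T : ℝ,
    C ν x = lommelR n (ν + 1) x * C (ν + n) x + S * C (ν + n + 1) x ∧
    C (ν + 1) x = lommelPrev n (ν + 1) x * C (ν + n) x + T * C (ν + n + 1) x := by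
  induction n generalizing ν with
  | zero =>
    exact ⟨0, 1, by simp [lommelR_zero (by positivity : 0 < ν + 1)], by simp [lommelPrev]⟩
  | succ n ih =>
    obtain ⟨S, T, h1, h2⟩ := ih (ν := ν + 1) (by positivity)
    have e : ν + ((n + 1 : ℕ) : ℝ) = ν + 1 + n := by push_cast; ring
    rw [e]
    refine ⟨2 * (ν + 1) / x * S - T, S, ?_, h1⟩
    rw [hC.recurrence hν hx, lommelR_succ n (by positivity) hx, h1, h2]
    ring

/-- The derivative of `y ^ (ν + 1) * C (ν + 1) y` is `y ^ (ν + 1) * C ν y`, so this product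
increases from positive values near the origin. -/
theorem pos_succ (hν : 0 < ν) (hpos : ∀ x ∈ Ioo 0 b, 0 < C ν x) (hx : x ∈ Ioc 0 b) :
    0 < C (ν + 1) x := by
  have hd : ∀ y : ℝ, 0 < y → HasDerivAt (fun y => y ^ (ν + 1) * C (ν + 1) y)
      (y ^ (ν + 1) * C ν y) y := by
    intro y hy
    have := (Real.hasDerivAt_rpow_const (p := ν + 1) (Or.inl hy.ne')).mul
      (hC.hasDerivAt_down hν hy)
    refine this.congr_deriv ?_
    rw [add_sub_cancel_right, Real.rpow_add_one hy.ne']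
    field_simp
    ring
  have hmono : StrictMonoOn (fun y => y ^ (ν + 1) * C (ν + 1) y) (Ioc 0 b) := by
    refine strictMonoOn_of_deriv_pos (convex_Ioc 0 b)
      (fun y hy => (hd y hy.1).continuousAt.continuousWithinAt) fun y hy => ?_
    rw [interior_Ioc] at hy
    rw [(hd y hy.1).deriv]
    exact mul_pos (Real.rpow_pos_of_pos hy.1 _) (hpos y hy)
  obtain ⟨a, ha0, hax, ha⟩ := hC.exists_pos (ν := ν + 1) (by positivity) hx.1
  have h1 := hmono ⟨ha0, hax.le.trans hx.2⟩ hx hax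
  have h2 : 0 < x ^ (ν + 1) * C (ν + 1) x :=
    (mul_pos (Real.rpow_pos_of_pos ha0 _) ha).trans h1
  exact pos_of_mul_pos_right h2 (Real.rpow_nonneg hx.1.le _)

/-- Positivity climbs the orders through `pos_succ`; Lommel's relation then writes `R_{n,ν+1}
C_{ν+1}` as a positive term plus a nonnegative one. -/
theorem pos_and_lommelR_pos (n : ℕ) (hν : 0 < ν) (hpos : ∀ x ∈ Ioo 0 b, 0 < C ν x)
    (hb : 0 ≤ C ν b) (hx : x ∈ Ioc 0 b) : 0 < C (ν + n + 1) x ∧ 0 < lommelR n (ν + 1) x := by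
  induction n generalizing ν with
  | zero =>
    simpa [lommelR_zero (by positivity : 0 < ν + 1)] using hC.pos_succ hν hpos hx
  | succ n ih =>
    have hp := fun y (hy : y ∈ Ioc 0 b) => hC.pos_succ hν hpos hy
    obtain ⟨h1, h2⟩ := ih (ν := ν + 1) (by positivity) (fun y hy => hp y ⟨hy.1, hy.2.le⟩)
      (hp b ⟨hx.1.trans_le hx.2, le_rfl⟩).le
    have e : ν + ((n + 1 : ℕ) : ℝ) + 1 = ν + 1 + n + 1 := by push_cast; ring
    have h3 := hC.eq_lommel_mul_sub (n + 1) hν hx.1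
    rw [e] at h3 ⊢
    refine ⟨h1, ?_⟩
    have hx0 : 0 ≤ C ν x := by
      rcases hx.2.lt_or_eq with h | h
      · exact (hpos x ⟨hx.1, h⟩).le
      · rw [h]; exact hb
    have h4 : 0 ≤ lommelPrev (n + 1) (ν + 1) x * C ν x := mul_nonneg h2.le hx0
    have h5 : 0 < lommelR (n + 1) (ν + 1) x * C (ν + 1) x := by linarith
    exact pos_of_mul_pos_left h5 (hp x hx).le

/-- Zeros are simple: the weighted energy `y ^ (2ν+2) (C_ν² + C_{ν+1}²)` is nondecreasing and
positive near `0`, so it never vanishes. -/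
theorem succ_ne_zero (hν : 0 < ν) (hx : 0 < x) (h0 : C ν x = 0) : C (ν + 1) x ≠ 0 := by
  intro h1
  have hd : ∀ y : ℝ, 0 < y → HasDerivAt
      (fun y => y ^ (2 * ν + 2) * (C ν y ^ 2 + C (ν + 1) y ^ 2))
      (y ^ (2 * ν + 1) * (4 * ν + 2) * C ν y ^ 2) y := by
    intro y hy
    have := (Real.hasDerivAt_rpow_const (p := 2 * ν + 2) (Or.inl hy.ne')).mul
      (((hC.hasDerivAt_up hν hy).fun_pow 2).add ((hC.hasDerivAt_down hν hy).fun_pow 2))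
    refine this.congr_deriv ?_
    have e : 2 * ν + 2 - 1 = 2 * ν + 1 := by ring
    have e' : y ^ (2 * ν + 2) = y ^ (2 * ν + 1) * y := by
      rw [← Real.rpow_add_one hy.ne']
      congr 1
      ring
    simp only [Pi.add_apply]
    rw [e, e']
    generalize y ^ (2 * ν + 1) = p
    field_simp
    ring
  have hmono : MonotoneOn (fun y => y ^ (2 * ν + 2) * (C ν y ^ 2 + C (ν + 1) y ^ 2)) (Ioi 0) := by
    refine monotoneOn_of_deriv_nonneg (convex_Ioi 0)
      (fun y hy => (hd y hy).continuousAt.continuousWithinAt) ?_ ?_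
    · rw [interior_Ioi]
      exact fun y hy => (hd y hy).differentiableAt.differentiableWithinAt
    · intro y hy
      rw [interior_Ioi] at hy
      have hy' : 0 < y := hy
      rw [(hd y hy).deriv]
      positivity
  obtain ⟨a, ha0, hax, ha⟩ := hC.exists_pos hν hx
  have h2 := hmono (mem_Ioi.2 ha0) (mem_Ioi.2 hx) hax.le
  have h3 : 0 < a ^ (2 * ν + 2) * (C ν a ^ 2 + C (ν + 1) a ^ 2) := by positivity
  simp only [h0, h1] at h2
  norm_num at h2
  linarith

/-- A Prüfer angle argument: without zeros beyond `b`, the angle `arctan (C_{ν+1} / C_ν)` would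
eventually grow at rate at least `1 / 2`, but it stays in an interval of length `π`. -/
theorem exists_zero_gt (hν : 0 < ν) (b : ℝ) : ∃ x, b < x ∧ 0 < x ∧ C ν x = 0 := by
  by_contra! hne
  -- The bound `2 * ν + 1` makes `t = (2 * ν + 1) / y` at most `1` below, so that `t * u ≤ (1 + u ^
  -- 2) / 2`.
  obtain ⟨X, hX⟩ : ∃ X : ℝ, X = max (|b| + 1) (2 * ν + 1) := ⟨_, rfl⟩
  have hXb : b < X := by
    have h1 := le_abs_self b
    have h2 := le_max_left (|b| + 1) (2 * ν + 1)
    rw [← hX] at h2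
    linarith
  have hXν : 2 * ν + 1 ≤ X := hX ▸ le_max_right _ _
  have hX0 : 0 < X := by linarith
  have hd : ∀ y : ℝ, X ≤ y → HasDerivAt
      (fun y => Real.arctan (C (ν + 1) y / C ν y) - y / 2)
      (1 / (1 + (C (ν + 1) y / C ν y) ^ 2) *
        (1 + (C (ν + 1) y / C ν y) ^ 2 - (2 * ν + 1) / y * (C (ν + 1) y / C ν y)) - 1 / 2) y := by
    intro y hy
    have hy0 : 0 < y := by linarith
    have hy1 : C ν y ≠ 0 := hne y (by linarith) hy0
    have := (((hC.hasDerivAt_down hν hy0).fun_div (hC.hasDerivAt_up hν hy0) hy1).arctan).sub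
      ((hasDerivAt_id' y).div_const 2)
    refine this.congr_deriv ?_
    congr 2
    field_simp
    ring
  have hmono : MonotoneOn (fun y => Real.arctan (C (ν + 1) y / C ν y) - y / 2) (Ici X) := by
    refine monotoneOn_of_deriv_nonneg (convex_Ici X)
      (fun y hy => (hd y hy).continuousAt.continuousWithinAt) ?_ ?_
    · intro y hy
      exact (hd y (interior_subset hy)).differentiableAt.differentiableWithinAt
    · intro y hy
      have hy' : X ≤ y := interior_subset hy
      rw [(hd y hy').deriv]
      set u := C (ν + 1) y / C ν y
      have ht0 : 0 ≤ (2 * ν + 1) / y := div_nonneg (by linarith) (by linarith)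
      have ht1 : (2 * ν + 1) / y ≤ 1 := by
        rw [div_le_one (by linarith)]
        linarith
      set t := (2 * ν + 1) / y
      have h1 : t * u ≤ (1 + u ^ 2) / 2 := by
        nlinarith [sq_nonneg (u - t)]
      have h2 : 0 < 1 + u ^ 2 := by positivity
      rw [sub_nonneg, div_mul_eq_mul_div, le_div_iff₀ h2]
      linarith
  -- Over a length of `4π` the angle gains at least `2π`.
  have h1 := hmono (mem_Ici.2 le_rfl) (mem_Ici.2 (by linarith [Real.pi_pos] : X ≤ X + 4 * Real.pi))
    (by linarith [Real.pi_pos])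
  have h2 := Real.arctan_lt_pi_div_two (C (ν + 1) (X + 4 * Real.pi) / C ν (X + 4 * Real.pi))
  have h3 := Real.neg_pi_div_two_lt_arctan (C (ν + 1) X / C ν X)
  simp only at h1
  linarith [Real.pi_pos]

theorem deriv_ne_zero_of_zero (hν : 0 < ν) (hx : 0 < x) (h0 : C ν x = 0) :
    ν / x * C ν x - C (ν + 1) x ≠ 0 := by
  have := hC.succ_ne_zero hν hx h0
  simpa [h0] using this

/-- Zeros keep away from the origin, so infinitely many would accumulate at a positive point;
simplicity of zeros forbids that. -/
theorem finite_zeros (hν : 0 < ν) (b : ℝ) : (positiveZeros (C ν) ∩ Iic b).Finite := by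
  by_contra hinf
  obtain ⟨a, ha0, ha⟩ := mem_nhdsGT_iff_exists_Ioo_subset.1 (hC.eventually_pos hν)
  have ha0 : 0 < a := ha0
  have hsub : positiveZeros (C ν) ∩ Iic b ⊆ Icc a b := by
    rintro x ⟨⟨hx0, hx⟩, hxb⟩
    refine ⟨?_, hxb⟩
    by_contra! hlt
    have h1 : 0 < C ν x := ha ⟨hx0, hlt⟩
    exact h1.ne' hx
  obtain ⟨x, hx, hacc⟩ := Set.Infinite.exists_accPt_of_subset_isCompact hinf isCompact_Icc hsub
  have hx0 : 0 < x := ha0.trans_le hx.1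
  have hev : ∀ᶠ y in 𝓝[≠] x, C ν y ≠ 0 := by
    by_cases h0 : C ν x = 0
    · exact (hC.hasDerivAt_up hν hx0).eventually_ne (hC.deriv_ne_zero_of_zero hν hx0 h0)
    · exact ((hC.hasDerivAt_up hν hx0).continuousAt.eventually_ne h0).filter_mono
        nhdsWithin_le_nhds
  rw [accPt_iff_frequently_nhdsNE] at hacc
  exact hacc (hev.mono fun y hy h => hy h.1.2)

end IsCylinderFamily

/-! ### Ascending enumerations and interlacing -/

/-- Iterates "next larger element". The list is exhaustive because a missed point would have
infinitely many elements of `s` below it. -/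
theorem exists_isAscendingEnumeration {s : Set ℝ} (hfin : ∀ b, (s ∩ Iic b).Finite)
    (hunb : ∀ b, ∃ x ∈ s, b < x) : ∃ u, IsAscendingEnumeration s u ∧
      (∀ x ∈ s, u 0 ≤ x) ∧ ∀ k, ∀ x ∈ s, u k < x → u (k + 1) ≤ x := by
  have hmin : ∀ b, ∃ y ∈ s, b < y ∧ ∀ x ∈ s, b < x → y ≤ x := by
    intro b
    obtain ⟨x0, hx0, hb0⟩ := hunb b
    have hf : (s ∩ Iic x0 ∩ Ioi b).Finite := (hfin x0).subset inter_subset_left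
    obtain ⟨y, hy, hymin⟩ := hf.exists_minimalFor id _ ⟨x0, ⟨hx0, mem_Iic.2 le_rfl⟩, hb0⟩
    refine ⟨y, hy.1.1, hy.2, fun x hx hbx => ?_⟩
    by_contra! hlt
    have := hymin (j := x) ⟨⟨hx, hlt.le.trans hy.1.2⟩, hbx⟩ hlt.le
    exact absurd hlt (not_lt.2 this)
  choose next hnext hlt hle using hmin
  have hfirst : ∃ y ∈ s, ∀ x ∈ s, y ≤ x := by
    obtain ⟨x0, hx0, -⟩ := hunb 0
    obtain ⟨y, hy, hymin⟩ := (hfin x0).exists_minimalFor id _ ⟨x0, hx0, mem_Iic.2 le_rfl⟩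
    refine ⟨y, hy.1, fun x hx => ?_⟩
    by_contra! hlt
    have := hymin (j := x) ⟨hx, hlt.le.trans hy.2⟩ hlt.le
    exact absurd hlt (not_lt.2 this)
  obtain ⟨y0, hy0, hy0min⟩ := hfirst
  let u : ℕ → ℝ := fun k => Nat.rec y0 (fun _ y => next y) k
  have hu : ∀ k, u (k + 1) = next (u k) := fun k => rfl
  have hmem : ∀ k, u k ∈ s := by
    intro k
    cases k with
    | zero => exact hy0
    | succ k => rw [hu]; exact hnext _
  have hmono : StrictMono u := strictMono_nat_of_lt_succ fun k => by rw [hu]; exact hlt _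
  have hstep : ∀ k, ∀ x ∈ s, u k < x → u (k + 1) ≤ x := fun k x hx h => by
    rw [hu]; exact hle _ x hx h
  refine ⟨u, ⟨hmono, Subset.antisymm (range_subset_iff.2 hmem) fun x hx => ?_⟩, hy0min, hstep⟩
  by_contra hnot
  have hall : ∀ k, u k < x := by
    intro k
    induction k with
    | zero => exact lt_of_le_of_ne (hy0min x hx) fun h => hnot ⟨0, h⟩
    | succ k ih => exact lt_of_le_of_ne (hstep k x hx ih) fun h => hnot ⟨k + 1, h⟩
  exact (infinite_range_of_injective hmono.injective)
    ((hfin x).subset (range_subset_iff.2 fun k => ⟨hmem k, (hall k).le⟩))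

theorem IsAscendingEnumeration.interlace {s t : Set ℝ} {c : ℕ → ℝ}
    (hc : IsAscendingEnumeration s c) (hgt : ∀ x ∈ t, c 0 < x) (hdisj : ∀ x ∈ t, x ∉ s)
    (huniq : ∀ k, ∃! x, x ∈ t ∧ x ∈ Ioo (c k) (c (k + 1)))
    (hfin : ∀ b, (s ∩ Iic b).Finite) : ∃ τ, IsAscendingEnumeration t τ ∧
      ∀ k, c k < τ k ∧ τ k < c (k + 1) := by
  choose τ hτ hτu using huniq
  refine ⟨τ, ⟨strictMono_nat_of_lt_succ fun k => (hτ k).2.2.trans (hτ (k + 1)).2.1, ?_⟩,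
    fun k => (hτ k).2⟩
  refine Subset.antisymm (range_subset_iff.2 fun k => (hτ k).1) fun x hx => ?_
  have hex : ∃ k, x ≤ c (k + 1) := by
    by_contra! h
    have hall : ∀ k, c k ≤ x := fun k =>
      (hc.1.monotone (Nat.le_succ k)).trans (h k).le
    refine (infinite_range_of_injective hc.1.injective) ((hfin x).subset ?_)
    rw [range_subset_iff]
    exact fun k => ⟨hc.2 ▸ mem_range_self k, hall k⟩
  classical
  have hne : ∀ k, x ≠ c k := fun k h => hdisj x hx (h ▸ hc.2 ▸ mem_range_self k)
  obtain ⟨k, hk, hkmin⟩ : ∃ k, x ≤ c (k + 1) ∧ ∀ j < k, ¬ x ≤ c (j + 1) :=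
    ⟨Nat.find hex, Nat.find_spec hex, fun j => Nat.find_min hex⟩
  have hlt : c k < x := by
    cases k with
    | zero => exact hgt x hx
    | succ j => exact not_le.1 (hkmin j (Nat.lt_succ_self j))
  exact ⟨k, (hτu k x ⟨hx, hlt, lt_of_le_of_ne hk (hne _)⟩).symm⟩

/-- If `f a` is nonnegative and the derivative of `f` is positive at each zero of `f` in `[a, b]`,
then `f b` is positive. -/
theorem pos_of_deriv_pos_at_zeros {f f' : ℝ → ℝ} {a b : ℝ} (hab : a < b)
    (hd : ∀ x ∈ Icc a b, HasDerivAt f (f' x) x) (hz : ∀ x ∈ Icc a b, f x = 0 → 0 < f' x)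
    (ha : 0 ≤ f a) : 0 < f b := by
  have hnn : ∀ x ∈ Icc a b, 0 ≤ f x := by
    intro x hx
    refine image_le_of_deriv_right_lt_deriv_boundary' (f := fun _ => (0 : ℝ)) (f' := fun _ => 0)
      (B := f) (B' := f') (a := a) (b := b) continuousOn_const
      (fun y _ => hasDerivWithinAt_const _ _ _) ha
      (fun y hy => (hd y hy).continuousAt.continuousWithinAt)
      (fun y hy => (hd y (Ico_subset_Icc_self hy)).hasDerivWithinAt)
      (fun y hy h => hz y (Ico_subset_Icc_self hy) h.symm) hx
  have hb : b ∈ Icc a b := right_mem_Icc.2 hab.le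
  refine lt_of_le_of_ne (hnn b hb) fun h0 => ?_
  -- If `f b = 0`, the positive derivative would make `f` negative just to the left of `b`.
  have hev := eventually_nhdsWithin_sign_eq_of_deriv_pos (f := f) (x₀ := b)
    (by rw [(hd b hb).deriv]; exact hz b hb h0.symm) h0.symm
  have hev2 : ∀ᶠ x in 𝓝[<] b, x ∈ Ioo a b := Ioo_mem_nhdsLT hab
  obtain ⟨y, h1, h2⟩ := ((hev.filter_mono nhdsWithin_le_nhds).and hev2).exists
  rw [sign_neg (by linarith [h2.2] : y - b < 0), sign_eq_neg_one_iff] at h1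
  exact absurd (hnn y (Ioo_subset_Icc_self h2)) (not_le.2 h1)

/-- If `g ≠ 0` on `(a, b)`, `g` has simple zeros at `a` and `b` where `g' f < 0`, and `g f' > 0` at
the zeros of `f` in `(a, b)`, then `f` has exactly one zero in `(a, b)`. -/
theorem existsUnique_zero_between {f f' g g' : ℝ → ℝ} {a b : ℝ} (hab : a < b)
    (hf : ∀ x ∈ Icc a b, HasDerivAt f (f' x) x) (hg : ∀ x ∈ Icc a b, HasDerivAt g (g' x) x)
    (hg0 : ∀ x ∈ Ioo a b, g x ≠ 0) (hga : g a = 0) (hgb : g b = 0)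
    (hfa : g' a * f a < 0) (hfb : g' b * f b < 0)
    (hz : ∀ x ∈ Ioo a b, f x = 0 → 0 < g x * f' x) : ∃! x, f x = 0 ∧ x ∈ Ioo a b := by
  -- Negating `f` and `g` together preserves every hypothesis, all being products of one with the
  -- other.
  wlog hpos : ∀ x ∈ Ioo a b, 0 < g x generalizing f f' g g'
  · have hneg : ∀ x ∈ Ioo a b, 0 < -g x := by
      push Not at hpos
      obtain ⟨y, hy, hy0⟩ := hpos
      intro x hx
      by_contra! hx0
      have hcont : ContinuousOn g (Ioo a b) := fun z hz =>
        (hg z (Ioo_subset_Icc_self hz)).continuousAt.continuousWithinAt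
      obtain ⟨z, hzm, hz0⟩ := isPreconnected_Ioo.intermediate_value hy hx hcont
        (⟨hy0, by linarith⟩ : (0 : ℝ) ∈ Icc (g y) (g x))
      exact hg0 z hzm hz0
    have := this (f := fun x => -f x) (f' := fun x => -f' x) (g := fun x => -g x)
      (g' := fun x => -g' x) (fun x hx => (hf x hx).neg) (fun x hx => (hg x hx).neg)
      (fun x hx => neg_ne_zero.2 (hg0 x hx)) (by simp [hga]) (by simp [hgb])
      (by simpa using hfa) (by simpa using hfb)
      (fun x hx h => by simpa using hz x hx (neg_eq_zero.1 h)) hneg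
    simpa using this
  have ha : a ∈ Icc a b := left_mem_Icc.2 hab.le
  have hb : b ∈ Icc a b := right_mem_Icc.2 hab.le
  have hga' : 0 ≤ g' a := by
    have ht : Tendsto (slope g a) (𝓝[>] a) (𝓝 (g' a)) :=
      (hasDerivAt_iff_tendsto_slope.1 (hg a ha)).mono_left
        (nhdsWithin_mono a fun x hx => ne_of_gt hx)
    refine ge_of_tendsto ht ?_
    filter_upwards [Ioo_mem_nhdsGT hab] with y hy
    rw [slope_def_field, hga, sub_zero]
    exact div_nonneg (hpos y hy).le (by linarith [hy.1])
  have hgb' : g' b ≤ 0 := by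
    have ht : Tendsto (slope g b) (𝓝[<] b) (𝓝 (g' b)) :=
      (hasDerivAt_iff_tendsto_slope.1 (hg b hb)).mono_left
        (nhdsWithin_mono b fun x hx => ne_of_lt hx)
    refine le_of_tendsto ht ?_
    filter_upwards [Ioo_mem_nhdsLT hab] with y hy
    rw [slope_def_field, hgb, sub_zero]
    exact div_nonpos_of_nonneg_of_nonpos (hpos y hy).le (by linarith [hy.2])
  have hfa0 : f a < 0 := by
    by_contra! h
    exact absurd (mul_nonneg hga' h) (not_le.2 hfa)
  have hfb0 : 0 < f b := by
    by_contra! h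
    exact absurd (mul_nonneg_of_nonpos_of_nonpos hgb' h) (not_le.2 hfb)
  have hcont : ContinuousOn f (Icc a b) := fun z hz => (hf z hz).continuousAt.continuousWithinAt
  obtain ⟨x, hx, hx0⟩ := intermediate_value_Ioo hab.le hcont
    (⟨hfa0, hfb0⟩ : (0 : ℝ) ∈ Ioo (f a) (f b))
  -- Starting from a zero, `f` must be strictly positive at every later point of the interval, so a
  -- second zero is impossible.
  have key : ∀ y ∈ Ioo a b, ∀ z ∈ Ioo a b, f y = 0 → f z = 0 → ¬ y < z := by
    intro y hy z hz' hy0 hz0 hlt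
    have hsub : ∀ w ∈ Icc y z, w ∈ Ioo a b := fun w hw =>
      ⟨hy.1.trans_le hw.1, hw.2.trans_lt hz'.2⟩
    have := pos_of_deriv_pos_at_zeros hlt (fun w hw => hf w (Ioo_subset_Icc_self (hsub w hw)))
      (fun w hw hw0 => pos_of_mul_pos_right (hz w (hsub w hw) hw0) (hpos w (hsub w hw)).le)
      hy0.ge
    exact this.ne' hz0
  refine ⟨x, ⟨hx0, hx⟩, fun y hy => ?_⟩
  exact le_antisymm (not_lt.1 (key x hx y hy.2 hx0 hy.1)) (not_lt.1 (key y hy.2 x hx hy.1 hx0))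

theorem IsCylinderFamily.interlacing {C : ℝ → ℝ → ℝ} (hC : IsCylinderFamily C) {ν : ℝ}
    (hν : 0 < ν) (n : ℕ) (hM : ∀ x, 0 < x → C ν x = 0 → C (ν + n + 1) x ≠ 0) :
    ∃ c τ : ℕ → ℝ, IsAscendingEnumeration (positiveZeros (C ν)) c ∧
      IsAscendingEnumeration
        (positiveZeros (C (ν + n + 1)) ∪ positiveZeros (lommelR n (ν + 1))) τ ∧
      0 < c 0 ∧ ∀ k, c k < τ k ∧ τ k < c (k + 1) := by
  obtain ⟨c, hc, hc0, hcs⟩ := exists_isAscendingEnumeration (hC.finite_zeros hν) fun b => by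
    obtain ⟨x, h1, h2, h3⟩ := hC.exists_zero_gt hν b
    exact ⟨x, ⟨h2, h3⟩, h1⟩
  have hcz : ∀ k, 0 < c k ∧ C ν (c k) = 0 := fun k => by
    have : c k ∈ positiveZeros (C ν) := hc.2 ▸ mem_range_self k
    exact this
  have hunion : ∀ x, x ∈ positiveZeros (C (ν + n + 1)) ∪ positiveZeros (lommelR n (ν + 1)) ↔
      0 < x ∧ lommelR n (ν + 1) x * C (ν + n + 1) x = 0 := by
    intro x
    simp only [positiveZeros, mem_union, mem_ofPred_eq, mul_eq_zero]
    tauto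
  have hf : ∀ x, 0 < x → HasDerivAt (fun x => lommelR n (ν + 1) x * C (ν + n + 1) x)
      (deriv (lommelR n (ν + 1)) x * C (ν + n + 1) x + lommelR n (ν + 1) x *
        (C (ν + n) x - (ν + n + 1) / x * C (ν + n + 1) x)) x := fun x hx =>
    (differentiableAt_lommelR n (ν + 1) hx).hasDerivAt.mul
      (hC.hasDerivAt_down (by positivity) hx)
  have hend : ∀ x, 0 < x → C ν x = 0 → (ν / x * C ν x - C (ν + 1) x) *
      (lommelR n (ν + 1) x * C (ν + n + 1) x) < 0 := by
    intro x hx h0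
    have h1 := hC.eq_lommel_mul_sub n hν hx
    have h2 := hM x hx h0
    rw [h1] at h2 ⊢
    rw [h0] at h2 ⊢
    have h3 : 0 < (lommelR n (ν + 1) x * C (ν + 1) x) ^ 2 := by
      have : lommelR n (ν + 1) x * C (ν + 1) x ≠ 0 := by simpa using h2
      positivity
    nlinarith
  have hzero : ∀ x, 0 < x → C ν x ≠ 0 → lommelR n (ν + 1) x * C (ν + n + 1) x = 0 →
      0 < C ν x * (deriv (lommelR n (ν + 1)) x * C (ν + n + 1) x + lommelR n (ν + 1) x *
        (C (ν + n) x - (ν + n + 1) / x * C (ν + n + 1) x)) := by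
    intro x hx hne h0
    -- When `R = 0`, the sign comes from the Wronskian inequality; otherwise `C_{ν+n+1} = 0` and the
    -- inverse relation turns the product into a square.
    by_cases hR : lommelR n (ν + 1) x = 0
    · have h1 := hC.eq_lommel_mul_sub n hν hx
      have h2 := lommelPrev_mul_deriv_neg n (by positivity : 0 < ν + 1) hx hR
      rw [h1, hR]
      have h3 : 0 < C ν x ^ 2 := by positivity
      nlinarith
    · have hCz : C (ν + n + 1) x = 0 := (mul_eq_zero.1 h0).resolve_left hR
      obtain ⟨S, T, h1, -⟩ := hC.exists_eq_lommel_mul_add n hν hx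
      rw [hCz, mul_zero, add_zero] at h1
      rw [hCz, ← sub_zero (C (ν + n) x)]
      have h2 : 0 < C ν x ^ 2 := by positivity
      calc 0 < C ν x ^ 2 := h2
        _ = _ := by rw [h1]; ring
  have hpos0 : ∀ x ∈ Ioo 0 (c 0), 0 < C ν x := by
    intro x hx
    by_contra! hle
    obtain ⟨a, ha0, hax, ha⟩ := hC.exists_pos hν hx.1
    obtain ⟨z, hz, hz0⟩ := intermediate_value_Icc' hax.le
      ((hC.continuousOn hν).mono fun y hy => ha0.trans_le hy.1)
      (⟨hle, ha.le⟩ : (0 : ℝ) ∈ Icc (C ν x) (C ν a))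
    exact absurd (hc0 z ⟨ha0.trans_le hz.1, hz0⟩) (not_le.2 (hz.2.trans_lt hx.2))
  obtain ⟨τ, hτ, hcτ⟩ := hc.interlace
    (t := positiveZeros (C (ν + n + 1)) ∪ positiveZeros (lommelR n (ν + 1)))
    (fun x hx => by
      rw [hunion] at hx
      by_contra! hle
      obtain ⟨h1, h2⟩ := hC.pos_and_lommelR_pos n hν hpos0 (hcz 0).2.ge ⟨hx.1, hle⟩
      exact (mul_pos h2 h1).ne' hx.2)
    (fun x hx hs => by
      rw [hunion] at hx
      have := hend x hs.1 hs.2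
      rw [hx.2, mul_zero] at this
      exact lt_irrefl _ this)
    (fun k => by
      have hI : ∀ x ∈ Icc (c k) (c (k + 1)), 0 < x := fun x hx => (hcz k).1.trans_le hx.1
      have hne : ∀ x ∈ Ioo (c k) (c (k + 1)), C ν x ≠ 0 := fun x hx h0 =>
        absurd (hcs k x ⟨(hcz k).1.trans hx.1, h0⟩ hx.1) (not_le.2 hx.2)
      have := existsUnique_zero_between (hc.1 (Nat.lt_succ_self k)) (fun x hx => hf x (hI x hx))
        (fun x hx => hC.hasDerivAt_up hν (hI x hx)) hne (hcz k).2 (hcz (k + 1)).2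
        (hend _ (hcz k).1 (hcz k).2) (hend _ (hcz (k + 1)).1 (hcz (k + 1)).2)
        (fun x hx => hzero x (hI x (Ioo_subset_Icc_self hx)) (hne x hx))
      refine (existsUnique_congr fun x => ?_).1 this
      rw [hunion]
      exact ⟨fun h => ⟨⟨(hcz k).1.trans h.2.1, h.1⟩, h.2⟩, fun h => ⟨h.1.2, h.2⟩⟩)
    (hC.finite_zeros hν)
  exact ⟨c, τ, hc, hτ, (hcz 0).1, hcτ⟩

/-! ### The reciprocal Gamma function -/

/-- The reciprocal of the Gamma function. -/
noncomputable def rGamma (s : ℝ) : ℝ := (Real.Gamma s)⁻¹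

theorem rGamma_eq_mul (s : ℝ) : rGamma s = s * rGamma (s + 1) := by
  rcases eq_or_ne s 0 with rfl | h
  · simp [rGamma, Real.Gamma_zero]
  · rw [rGamma, rGamma, Real.Gamma_add_one h, mul_inv, mul_inv_cancel_left₀ h]

theorem contDiff_rGamma : ContDiff ℝ 1 rGamma := by
  have h := (Complex.differentiable_one_div_Gamma.contDiff (n := 1)).real_of_complex
  have e : rGamma = fun x : ℝ => ((Complex.Gamma x)⁻¹).re := by
    ext x
    rw [rGamma, Complex.Gamma_ofReal, ← Complex.ofReal_inv, Complex.ofReal_re]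
  rwa [e]

theorem hasDerivAt_rGamma (s : ℝ) : HasDerivAt rGamma (deriv rGamma s) s :=
  (contDiff_rGamma.differentiable one_ne_zero s).hasDerivAt

theorem deriv_rGamma_eq (s : ℝ) :
    deriv rGamma s = s * deriv rGamma (s + 1) + rGamma (s + 1) := by
  have h1 : HasDerivAt (fun y : ℝ => y * rGamma (y + 1))
      (1 * rGamma (s + 1) + s * deriv rGamma (s + 1)) s :=
    (hasDerivAt_id' s).mul ((hasDerivAt_rGamma (s + 1)).comp_add_const s 1)
  have h2 : rGamma = fun y : ℝ => y * rGamma (y + 1) := funext rGamma_eq_mul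
  rw [← h2] at h1
  rw [h1.deriv]
  ring

/-- `1/Γ` vanishes at `-n`, so passing from `-n` to `-(n+1)` multiplies its derivative by `-(n+1)`.
This fixes the sign of `Y` near `0` at integer orders. -/
theorem neg_one_pow_mul_deriv_rGamma_neg (n : ℕ) : 0 < (-1) ^ n * deriv rGamma (-n) := by
  induction n with
  | zero =>
    rw [deriv_rGamma_eq]
    simp [rGamma]
  | succ n ih =>
    have e : (-((n + 1 : ℕ) : ℝ)) + 1 = -n := by push_cast; ring
    have h0 : rGamma (-n) = 0 := by rw [rGamma, Real.Gamma_neg_nat_eq_zero, inv_zero]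
    rw [deriv_rGamma_eq, e, h0, pow_succ]
    have : 0 < ((n + 1 : ℕ) : ℝ) * ((-1) ^ n * deriv rGamma (-n)) := by positivity
    linarith

/-- Boundedness on every right half-line. -/
def BddRight (g : ℝ → ℝ) : Prop := ∀ N : ℝ, ∃ M : ℝ, 0 ≤ M ∧ ∀ s, N ≤ s → |g s| ≤ M

/-- Compactness bounds `g` on a starting interval and unit steps carry the bound to the right. The
threshold `M₀` leaves room for an inhomogeneous term, as in the functional equation of `deriv
rGamma`. -/
theorem bddRight_of_step {g : ℝ → ℝ} (hg : Continuous g) (a M₀ : ℝ)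
    (hstep : ∀ M, M₀ ≤ M → ∀ s, a ≤ s → |g s| ≤ M → |g (s + 1)| ≤ M) : BddRight g := by
  intro N
  obtain ⟨M₁, hM₁⟩ := (isCompact_Icc (a := min N a) (b := a + 1)).exists_bound_of_continuousOn
    hg.continuousOn
  have h0 : 0 ≤ max M₁ M₀ := by
    have hm : min N a ∈ Icc (min N a) (a + 1) := ⟨le_rfl, by linarith [min_le_right N a]⟩
    exact (norm_nonneg _).trans ((hM₁ _ hm).trans (le_max_left _ _))
  have key : ∀ n : ℕ, ∀ s, min N a ≤ s → s ≤ a + 1 + n → |g s| ≤ max M₁ M₀ := by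
    intro n
    induction n with
    | zero =>
      intro s h1 h2
      exact (hM₁ s ⟨h1, by simpa using h2⟩).trans (le_max_left _ _)
    | succ n ih =>
      intro s h1 h2
      push_cast at h2
      by_cases h : s ≤ a + 1
      · exact (hM₁ s ⟨h1, h⟩).trans (le_max_left _ _)
      · have h3 : a ≤ s - 1 := by linarith [not_le.1 h]
        have := hstep _ (le_max_right _ _) (s - 1) h3
          (ih (s - 1) ((min_le_right _ _).trans h3) (by linarith))
        simpa using this
  refine ⟨max M₁ M₀, h0, fun s hs => ?_⟩
  obtain ⟨n, hn⟩ := exists_nat_ge (s - a - 1)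
  exact key n s ((min_le_left _ _).trans hs) (by linarith)

theorem bddRight_rGamma : BddRight rGamma := by
  refine bddRight_of_step contDiff_rGamma.continuous 1 0 fun M _ s hs h => ?_
  rw [rGamma_eq_mul s, abs_mul] at h
  have h1 : 1 ≤ |s| := hs.trans (le_abs_self s)
  nlinarith [abs_nonneg (rGamma (s + 1))]

theorem bddRight_deriv_rGamma : BddRight (deriv rGamma) := by
  obtain ⟨M₀, -, hM₀⟩ := bddRight_rGamma 0
  refine bddRight_of_step (contDiff_rGamma.continuous_deriv le_rfl) 2 M₀ fun M hM s hs h => ?_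
  have h1 : s * deriv rGamma (s + 1) = deriv rGamma s - rGamma (s + 1) := by
    rw [deriv_rGamma_eq s]; ring
  have h2 : |s * deriv rGamma (s + 1)| ≤ M + M := by
    rw [h1]
    exact (abs_sub _ _).trans (add_le_add h ((hM₀ _ (by linarith)).trans hM))
  rw [abs_mul] at h2
  have h3 : 2 ≤ |s| := hs.trans (le_abs_self s)
  nlinarith [abs_nonneg (deriv rGamma (s + 1))]

/-! ### Power series with coefficients `g (μ + k + 1) / k!` -/

/-- The series `∑ (-z)^k / k! * g (μ + k + 1)`. -/
noncomputable def besselSeries (g : ℝ → ℝ) (μ z : ℝ) : ℝ :=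
  ∑' k : ℕ, (-z) ^ k / (k.factorial : ℝ) * g (μ + k + 1)

section Series

variable {g g' e : ℝ → ℝ}

theorem hasSum_besselSeries (hg : BddRight g) (μ z : ℝ) :
    HasSum (fun k : ℕ => (-z) ^ k / (k.factorial : ℝ) * g (μ + k + 1)) (besselSeries g μ z) := by
  obtain ⟨M, hM0, hM⟩ := hg μ
  refine Summable.hasSum (Summable.of_norm_bounded
    ((Real.summable_pow_div_factorial |z|).mul_right M) fun k => ?_)
  rw [norm_mul, norm_div, norm_pow, norm_neg, Real.norm_eq_abs, Real.norm_eq_abs, Real.norm_eq_abs,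
    Nat.abs_cast]
  gcongr
  exact hM _ (by linarith [k.cast_nonneg (α := ℝ)])

theorem besselSeries_zero_right (g : ℝ → ℝ) (μ : ℝ) : besselSeries g μ 0 = g (μ + 1) := by
  rw [besselSeries, tsum_eq_single 0 fun k hk => by simp [hk]]
  simp

theorem hasSum_besselSeries_shift (hg : BddRight g) (μ z : ℝ) :
    HasSum (fun k : ℕ => k * (-z) ^ (k - 1) / (k.factorial : ℝ) * g (μ + k + 1))
      (besselSeries g (μ + 1) z) := by
  rw [← hasSum_nat_add_iff' 1]
  simp only [Finset.range_one, Finset.sum_singleton, Nat.cast_zero, zero_mul, zero_div, sub_zero]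
  refine (hasSum_besselSeries hg (μ + 1) z).congr_fun fun k => ?_
  have e1 : μ + ((k + 1 : ℕ) : ℝ) + 1 = μ + 1 + k + 1 := by push_cast; ring
  rw [e1, Nat.add_sub_cancel, Nat.factorial_succ]
  have : (k.factorial : ℝ) ≠ 0 := by positivity
  push_cast
  field_simp

theorem hasDerivAt_besselSeries (hg : BddRight g) (μ z : ℝ) :
    HasDerivAt (besselSeries g μ) (-besselSeries g (μ + 1) z) z := by
  obtain ⟨M, hM0, hM⟩ := hg μ
  have hu : Summable fun k : ℕ => k * (|z| + 1) ^ (k - 1) / (k.factorial : ℝ) * M := by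
    -- The majorant is itself a shifted series: constant coefficient function `M`, argument `-(|z| +
    -- 1)`.
    have := (hasSum_besselSeries_shift (g := fun _ => M) (fun N => ⟨M, hM0, fun s _ =>
      (abs_of_nonneg hM0).le⟩) 0 (-(|z| + 1))).summable
    simpa only [neg_neg] using this
  have hz : z ∈ Metric.ball (0 : ℝ) (|z| + 1) := by simp
  have h := hasDerivAt_tsum_of_isPreconnected (t := Metric.ball (0 : ℝ) (|z| + 1))
    (g := fun (k : ℕ) (w : ℝ) => (-w) ^ k / (k.factorial : ℝ) * g (μ + k + 1))
    (g' := fun (k : ℕ) (w : ℝ) => -(k * (-w) ^ (k - 1) / (k.factorial : ℝ) * g (μ + k + 1)))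
    hu Metric.isOpen_ball (convex_ball _ _).isPreconnected
    (fun k w _ => by
      refine ((((hasDerivAt_id' w).fun_neg.fun_pow k).div_const _).mul_const _).congr_deriv ?_
      ring)
    (fun k w hw => by
      rw [norm_neg, norm_mul, norm_div, norm_mul, norm_pow, norm_neg]
      simp only [Real.norm_eq_abs, Nat.abs_cast]
      have hw' : |w| ≤ |z| + 1 := by
        rw [mem_ball_zero_iff, Real.norm_eq_abs] at hw
        exact hw.le
      gcongr
      exact hM _ (by linarith [k.cast_nonneg (α := ℝ)]))
    hz (hasSum_besselSeries hg μ z).summable hz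
  rwa [(hasSum_besselSeries_shift hg μ z).neg.tsum_eq] at h

theorem hasDerivAt_besselSeries_order (hd : ∀ s, HasDerivAt g (g' s) s) (hg : BddRight g)
    (hg' : BddRight g') (μ z : ℝ) :
    HasDerivAt (fun μ => besselSeries g μ z) (besselSeries g' μ z) μ := by
  obtain ⟨M, hM0, hM⟩ := hg' (μ - 1)
  have hμ : μ ∈ Metric.ball μ 1 := by simp
  exact hasDerivAt_tsum_of_isPreconnected (t := Metric.ball μ 1)
    (g := fun (k : ℕ) (w : ℝ) => (-z) ^ k / (k.factorial : ℝ) * g (w + k + 1))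
    (g' := fun (k : ℕ) (w : ℝ) => (-z) ^ k / (k.factorial : ℝ) * g' (w + k + 1))
    ((Real.summable_pow_div_factorial |z|).mul_right M) Metric.isOpen_ball
    (convex_ball _ _).isPreconnected
    (fun k w _ => by
      have := (hd (w + k + 1)).comp w (((hasDerivAt_id' w).add_const (k : ℝ)).add_const 1)
      rw [mul_one] at this
      exact this.const_mul _)
    (fun k w hw => by
      rw [norm_mul, norm_div, norm_pow, norm_neg]
      simp only [Real.norm_eq_abs, Nat.abs_cast]
      have hw' := (abs_lt.1 (Real.dist_eq w μ ▸ Metric.mem_ball.1 hw)).1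
      gcongr
      exact hM _ (by linarith [k.cast_nonneg (α := ℝ)]))
    hμ (hasSum_besselSeries hg μ z).summable hμ

/-- The factor `μ + k + 1` is split into `μ + 1` and `k`, the latter shifting the series. The term
`e` lets one lemma serve `1/Γ` (`e = 0`) and its derivative (`e = 1/Γ`). -/
theorem besselSeries_eq_of_eq_mul_add (hg : BddRight g) (he : BddRight e)
    (h : ∀ s, g s = s * g (s + 1) + e (s + 1)) (μ z : ℝ) :
    besselSeries g μ z = (μ + 1) * besselSeries g (μ + 1) z - z * besselSeries g (μ + 2) z +
      besselSeries e (μ + 1) z := by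
  have h1 := ((((hasSum_besselSeries hg (μ + 1) z).mul_left (μ + 1)).add
    ((hasSum_besselSeries_shift hg (μ + 1) z).mul_left (-z))).add
    (hasSum_besselSeries he (μ + 1) z))
  have h2 := (hasSum_besselSeries hg μ z)
  have e2 : μ + 1 + 1 = μ + 2 := by ring
  rw [e2] at h1
  rw [sub_eq_add_neg, ← neg_mul]
  refine h2.unique (h1.congr_fun fun k => ?_)
  have e1 : μ + 1 + (k : ℝ) + 1 = μ + k + 1 + 1 := by ring
  rw [h (μ + k + 1), e1]
  have h3 : -z * (k * (-z) ^ (k - 1)) = k * (-z) ^ k := by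
    cases k with
    | zero => simp
    | succ k => rw [Nat.add_sub_cancel, pow_succ]; ring
  linear_combination (-(1 / (k.factorial : ℝ) * g (μ + k + 1 + 1))) * h3

/-- The function `(x/2)^μ ∑ (-1)^k / k! * g (μ + k + 1) (x/2)^(2k)`. -/
noncomputable def besselK (g : ℝ → ℝ) (μ x : ℝ) : ℝ :=
  (x / 2) ^ μ * besselSeries g μ ((x / 2) ^ 2)

theorem hasDerivAt_besselK (hg : BddRight g) (μ : ℝ) {x : ℝ} (hx : 0 < x) :
    HasDerivAt (besselK g μ) (μ / x * besselK g μ x - besselK g (μ + 1) x) x := by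
  have hy : x / 2 ≠ 0 := by positivity
  have h1 := (Real.hasDerivAt_rpow_const (p := μ) (Or.inl hy)).comp x
    ((hasDerivAt_id' x).div_const 2)
  have h2 := (hasDerivAt_besselSeries hg μ ((x / 2) ^ 2)).comp x
    (((hasDerivAt_id' x).div_const 2).fun_pow 2)
  refine (h1.mul h2).congr_deriv ?_
  simp only [besselK, Function.comp_apply]
  rw [Real.rpow_sub_one hy, Real.rpow_add_one hy]
  field_simp
  ring

theorem besselK_eq_of_eq_mul_add (hg : BddRight g) (he : BddRight e)
    (h : ∀ s, g s = s * g (s + 1) + e (s + 1)) (μ : ℝ) {x : ℝ} (hx : 0 < x) :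
    besselK g μ x = 2 * (μ + 1) / x * besselK g (μ + 1) x - besselK g (μ + 2) x +
      2 / x * besselK e (μ + 1) x := by
  have hy : x / 2 ≠ 0 := by positivity
  have e2 : (x / 2) ^ (μ + 2) = (x / 2) ^ μ * (x / 2) ^ 2 := by
    rw [Real.rpow_add (by positivity)]; norm_cast
  rw [besselK, besselK, besselK, besselK, besselSeries_eq_of_eq_mul_add hg he h, e2,
    Real.rpow_add_one hy]
  field_simp

theorem tendsto_besselSeries_sq (hg : BddRight g) (μ : ℝ) :
    Tendsto (fun x : ℝ => besselSeries g μ ((x / 2) ^ 2)) (𝓝[>] 0) (𝓝 (g (μ + 1))) := by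
  have h1 : Continuous (besselSeries g μ) := continuous_iff_continuousAt.2 fun z =>
    (hasDerivAt_besselSeries hg μ z).continuousAt
  have h2 : Continuous fun x : ℝ => besselSeries g μ ((x / 2) ^ 2) := h1.comp (by fun_prop)
  have h3 := (h2.tendsto 0).mono_left (nhdsWithin_le_nhds (s := Ioi 0))
  simpa [besselSeries_zero_right] using h3

theorem hasDerivAt_besselK_order (hd : ∀ s, HasDerivAt g (g' s) s) (hg : BddRight g)
    (hg' : BddRight g') (μ : ℝ) {x : ℝ} (hx : 0 < x) :
    HasDerivAt (fun μ => besselK g μ x) (Real.log (x / 2) * besselK g μ x + besselK g' μ x) μ := by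
  have hy : 0 < x / 2 := by positivity
  have h1 := ((hasDerivAt_id' μ).const_rpow hy).mul
    (hasDerivAt_besselSeries_order hd hg hg' μ ((x / 2) ^ 2))
  refine h1.congr_deriv ?_
  simp only [besselK]
  ring

end Series

/-! ### Bessel functions of the first kind -/

theorem besselJ_eq_besselK (ν : ℝ) {x : ℝ} (hx : 0 < x) : besselJ ν x = besselK rGamma ν x := by
  rw [besselJ, besselK, besselSeries, ← tsum_mul_left]
  refine tsum_congr fun k => ?_
  have hy : 0 < x / 2 := by positivity
  have e1 : (x / 2) ^ (2 * (k : ℝ) + ν) = (x / 2) ^ ν * ((x / 2) ^ 2) ^ k := by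
    rw [add_comm, Real.rpow_add hy, ← pow_mul]
    norm_cast
  rw [e1, rGamma, neg_pow ((x / 2) ^ 2), ← div_eq_mul_inv]
  generalize ((x / 2) ^ 2) ^ k = p
  field_simp

theorem besselJ_eventuallyEq (ν : ℝ) {x : ℝ} (hx : 0 < x) :
    besselJ ν =ᶠ[𝓝 x] besselK rGamma ν := by
  filter_upwards [lt_mem_nhds hx] with y hy using besselJ_eq_besselK ν hy

theorem hasDerivAt_besselJ (ν : ℝ) {x : ℝ} (hx : 0 < x) :
    HasDerivAt (besselJ ν) (ν / x * besselJ ν x - besselJ (ν + 1) x) x := by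
  rw [besselJ_eq_besselK ν hx, besselJ_eq_besselK _ hx]
  exact (hasDerivAt_besselK bddRight_rGamma ν hx).congr_of_eventuallyEq (besselJ_eventuallyEq ν hx)

theorem besselJ_recurrence (ν : ℝ) {x : ℝ} (hx : 0 < x) :
    besselJ ν x = 2 * (ν + 1) / x * besselJ (ν + 1) x - besselJ (ν + 2) x := by
  simp only [besselJ_eq_besselK _ hx]
  have h := besselK_eq_of_eq_mul_add (e := fun _ => 0) bddRight_rGamma
    (fun _ => ⟨0, le_rfl, by simp⟩) (fun s => by rw [add_zero]; exact rGamma_eq_mul s) ν hx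
  have h0 : besselK (fun _ => 0) (ν + 1) x = 0 := by simp [besselK, besselSeries]
  rw [h, h0]
  ring

theorem hasDerivAt_besselJ_neg (ν : ℝ) {x : ℝ} (hx : 0 < x) :
    HasDerivAt (besselJ (-ν)) (besselJ (-(ν + 1)) x + ν / x * besselJ (-ν) x) x := by
  refine (hasDerivAt_besselJ (-ν) hx).congr_deriv ?_
  have h := besselJ_recurrence (-(ν + 1)) hx
  have e1 : -(ν + 1) + 1 = -ν := by ring
  have e2 : -(ν + 1) + 2 = -ν + 1 := by ring
  rw [e1, e2] at h
  rw [h]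
  ring

/-- Both sides obey the same three-term recurrence; at order `-1` its middle coefficient vanishes,
giving `J_{-1} = -J_1`. -/
theorem besselJ_neg_nat (n : ℕ) {x : ℝ} (hx : 0 < x) :
    besselJ (-n) x = (-1) ^ n * besselJ n x := by
  induction n using Nat.twoStepInduction with
  | zero => simp
  | one =>
    have := besselJ_recurrence (-1) hx
    norm_num at this
    simpa using this
  | more n h0 h1 =>
    have h2 := besselJ_recurrence (-((n + 2 : ℕ) : ℝ)) hx
    have h3 := besselJ_recurrence (n : ℝ) hx
    have e1 : -((n + 2 : ℕ) : ℝ) + 1 = -((n + 1 : ℕ) : ℝ) := by push_cast; ring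
    have e2 : -((n + 2 : ℕ) : ℝ) + 2 = -(n : ℝ) := by push_cast; ring
    have e3 : (n : ℝ) + 1 = ((n + 1 : ℕ) : ℝ) := by push_cast; ring
    have e4 : (n : ℝ) + 2 = ((n + 2 : ℕ) : ℝ) := by push_cast; ring
    rw [e1, e2, h0, h1] at h2
    rw [e3, e4] at h3
    rw [h2, h3, pow_succ, pow_succ]
    ring

/-- The derivative of `J_ν` with respect to the order. -/
noncomputable def besselJOrderDeriv (ν x : ℝ) : ℝ :=
  Real.log (x / 2) * besselJ ν x + besselK (deriv rGamma) ν x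

theorem hasDerivAt_besselJ_order (ν : ℝ) {x : ℝ} (hx : 0 < x) :
    HasDerivAt (fun ν => besselJ ν x) (besselJOrderDeriv ν x) ν := by
  have h : (fun ν => besselJ ν x) = fun ν => besselK rGamma ν x :=
    funext fun ν => besselJ_eq_besselK ν hx
  rw [h, besselJOrderDeriv, besselJ_eq_besselK ν hx]
  exact hasDerivAt_besselK_order hasDerivAt_rGamma bddRight_rGamma bddRight_deriv_rGamma ν hx

theorem hasDerivAt_besselJOrderDeriv (ν : ℝ) {x : ℝ} (hx : 0 < x) :
    HasDerivAt (besselJOrderDeriv ν)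
      (besselJ ν x / x + ν / x * besselJOrderDeriv ν x - besselJOrderDeriv (ν + 1) x) x := by
  have hy : x / 2 ≠ 0 := by positivity
  have h1 := (((hasDerivAt_id' x).div_const 2).log hy).mul (hasDerivAt_besselJ ν hx)
  refine (h1.add (hasDerivAt_besselK bddRight_deriv_rGamma ν hx)).congr_deriv ?_
  simp only [besselJOrderDeriv]
  field_simp
  ring

theorem besselJOrderDeriv_recurrence (ν : ℝ) {x : ℝ} (hx : 0 < x) :
    besselJOrderDeriv ν x = 2 * (ν + 1) / x * besselJOrderDeriv (ν + 1) x -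
      besselJOrderDeriv (ν + 2) x + 2 / x * besselJ (ν + 1) x := by
  simp only [besselJOrderDeriv]
  rw [besselJ_recurrence ν hx, besselK_eq_of_eq_mul_add bddRight_deriv_rGamma bddRight_rGamma
    deriv_rGamma_eq ν hx, ← besselJ_eq_besselK _ hx]
  ring

theorem hasDerivAt_besselJOrderDeriv_neg (ν : ℝ) {x : ℝ} (hx : 0 < x) :
    HasDerivAt (besselJOrderDeriv (-ν))
      (besselJOrderDeriv (-(ν + 1)) x + ν / x * besselJOrderDeriv (-ν) x - besselJ (-ν) x / x)
      x := by
  refine (hasDerivAt_besselJOrderDeriv (-ν) hx).congr_deriv ?_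
  have h := besselJOrderDeriv_recurrence (-(ν + 1)) hx
  have e1 : -(ν + 1) + 1 = -ν := by ring
  have e2 : -(ν + 1) + 2 = -ν + 1 := by ring
  rw [e1, e2] at h
  rw [h]
  ring

/-! ### Bessel functions of the second kind -/

theorem besselY_natCast (n : ℕ) {x : ℝ} (hx : 0 < x) :
    besselY n x =
      (besselJOrderDeriv n x + (-1) ^ n * besselJOrderDeriv (-n) x) / Real.pi := by
  have hcos : Real.cos (n * Real.pi) = (-1) ^ n := Real.cos_nat_mul_pi n
  have hsin : Real.sin (n * Real.pi) = 0 := Real.sin_nat_mul_pi n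
  have hmul : HasDerivAt (fun μ : ℝ => μ * Real.pi) Real.pi (n : ℝ) := by
    simpa using (hasDerivAt_id' (n : ℝ)).mul_const Real.pi
  have hN : HasDerivAt
      (fun μ => Real.cos (μ * Real.pi) * besselJ μ x - besselJ (-μ) x)
      ((-1) ^ n * besselJOrderDeriv n x + besselJOrderDeriv (-n) x) (n : ℝ) := by
    have h1 := (hmul.cos.mul (hasDerivAt_besselJ_order n hx)).sub
      ((hasDerivAt_besselJ_order (-n) hx).comp (n : ℝ) (hasDerivAt_neg' (n : ℝ)))
    refine h1.congr_deriv ?_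
    rw [hcos, hsin]
    ring
  have hD : HasDerivAt (fun μ => Real.sin (μ * Real.pi)) ((-1) ^ n * Real.pi) (n : ℝ) := by
    have h1 := hmul.sin
    rwa [hcos] at h1
  have hne : ((-1) ^ n * Real.pi : ℝ) ≠ 0 :=
    mul_ne_zero (pow_ne_zero _ (by norm_num)) Real.pi_ne_zero
  -- L'Hôpital's rule: numerator and denominator both vanish at `n`, so their quotient is a quotient
  -- of slopes.
  have hlim := (hasDerivAt_iff_tendsto_slope.1 hN).div (hasDerivAt_iff_tendsto_slope.1 hD) hne
  have hN0 : Real.cos (n * Real.pi) * besselJ n x - besselJ (-n) x = 0 := by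
    rw [hcos, besselJ_neg_nat n hx, sub_self]
  have hlim2 : Tendsto (fun μ => besselYQuot μ x) (𝓝[≠] (n : ℝ))
      (𝓝 (((-1) ^ n * besselJOrderDeriv n x + besselJOrderDeriv (-n) x) /
        ((-1) ^ n * Real.pi))) := by
    refine hlim.congr' ?_
    filter_upwards [self_mem_nhdsWithin] with μ hμ
    have hμ' : μ - n ≠ 0 := sub_ne_zero.2 hμ
    rw [Pi.div_apply, slope_def_field, slope_def_field, hN0, hsin, sub_zero, sub_zero, besselYQuot,
      div_div_div_cancel_right₀ hμ']
  rw [besselY, if_pos ⟨(n : ℤ), by simp⟩, hlim2.limUnder_eq]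
  have hsq : ((-1) ^ n * (-1) ^ n : ℝ) = 1 := by rw [← mul_pow]; norm_num
  rw [div_eq_div_iff hne Real.pi_ne_zero]
  linear_combination (-Real.pi * besselJOrderDeriv (-n) x) * hsq

theorem besselY_of_not_int {ν : ℝ} (h : ¬ ∃ n : ℤ, ν = n) (x : ℝ) :
    besselY ν x = (Real.cos (ν * Real.pi) * besselJ ν x - besselJ (-ν) x) /
      Real.sin (ν * Real.pi) := by
  rw [besselY, if_neg h, besselYQuot]

theorem sin_mul_pi_ne_zero {ν : ℝ} (h : ¬ ∃ n : ℤ, ν = n) : Real.sin (ν * Real.pi) ≠ 0 :=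
  Real.sin_ne_zero_iff.2 fun n hn => h ⟨n, (mul_right_cancel₀ Real.pi_ne_zero hn).symm⟩

theorem not_int_add_one {ν : ℝ} (h : ¬ ∃ n : ℤ, ν = n) : ¬ ∃ n : ℤ, ν + 1 = n := by
  rintro ⟨n, hn⟩
  exact h ⟨n - 1, by push_cast; linarith⟩

theorem exists_nat_eq_of_int {ν : ℝ} (hν : 0 < ν) (h : ∃ n : ℤ, ν = n) : ∃ n : ℕ, ν = n + 1 := by
  obtain ⟨z, rfl⟩ := h
  have hz : 0 < z := by exact_mod_cast hν
  obtain ⟨n, hn⟩ := Int.eq_ofNat_of_zero_le (by omega : 0 ≤ z - 1)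
  refine ⟨n, ?_⟩
  have : z = (n : ℤ) + 1 := by omega
  rw [this]
  push_cast
  ring

/-- At integer order, the extra terms `J_n / x` and `(-1)^n J_{-n} / x` cancel. At other orders,
raising `ν` by one flips the signs of both `cos (νπ)` and `sin (νπ)`. -/
theorem hasDerivAt_besselY {ν x : ℝ} (hν : 0 < ν) (hx : 0 < x) :
    HasDerivAt (besselY ν) (ν / x * besselY ν x - besselY (ν + 1) x) x := by
  by_cases h : ∃ n : ℤ, ν = n
  · obtain ⟨m, hm⟩ := exists_nat_eq_of_int hν h
    obtain ⟨n, rfl⟩ : ∃ n : ℕ, ν = n := ⟨m + 1, by rw [hm]; push_cast; ring⟩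
    have hev : besselY n =ᶠ[𝓝 x] fun x =>
        (besselJOrderDeriv n x + (-1) ^ n * besselJOrderDeriv (-n) x) / Real.pi := by
      filter_upwards [lt_mem_nhds hx] with y hy using besselY_natCast n hy
    have hd := ((hasDerivAt_besselJOrderDeriv n hx).add
      ((hasDerivAt_besselJOrderDeriv_neg n hx).const_mul ((-1) ^ n))).div_const Real.pi
    refine (hd.congr_of_eventuallyEq hev).congr_deriv ?_
    have h1 := besselY_natCast (n + 1) hx
    push_cast at h1
    have hsq : ((-1) ^ n * (-1) ^ n : ℝ) = 1 := by rw [← mul_pow]; norm_num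
    rw [h1, besselY_natCast n hx, besselJ_neg_nat n hx, pow_succ]
    have := Real.pi_ne_zero
    field_simp
    linear_combination (-besselJ n x) * hsq
  · have hs := sin_mul_pi_ne_zero h
    have hfun : besselY ν = fun x =>
        (Real.cos (ν * Real.pi) * besselJ ν x - besselJ (-ν) x) / Real.sin (ν * Real.pi) :=
      funext (besselY_of_not_int h)
    have hd := (((hasDerivAt_besselJ ν hx).const_mul (Real.cos (ν * Real.pi))).sub
      (hasDerivAt_besselJ_neg ν hx)).div_const (Real.sin (ν * Real.pi))
    rw [besselY_of_not_int (not_int_add_one h), hfun]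
    refine hd.congr_deriv ?_
    rw [add_mul, one_mul, Real.cos_add_pi, Real.sin_add_pi]
    field_simp
    ring

theorem besselY_recurrence {ν x : ℝ} (hν : 0 < ν) (hx : 0 < x) :
    besselY ν x = 2 * (ν + 1) / x * besselY (ν + 1) x - besselY (ν + 2) x := by
  have e1 : -(ν + 2) + 1 = -(ν + 1) := by ring
  have e2 : -(ν + 2) + 2 = -ν := by ring
  by_cases h : ∃ n : ℤ, ν = n
  · obtain ⟨m, hm⟩ := exists_nat_eq_of_int hν h
    obtain ⟨n, rfl⟩ : ∃ n : ℕ, ν = n := ⟨m + 1, by rw [hm]; push_cast; ring⟩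
    have h1 := besselY_natCast (n + 1) hx
    have h2 := besselY_natCast (n + 2) hx
    have hJ := besselJ_neg_nat (n + 1) hx
    push_cast at h1 h2 hJ
    have h3 := besselJOrderDeriv_recurrence n hx
    have h4 := besselJOrderDeriv_recurrence (-(n + 2)) hx
    rw [e1, e2, hJ] at h4
    have hsq : ((-1) ^ n * (-1) ^ n : ℝ) = 1 := by rw [← mul_pow]; norm_num
    rw [h1, h2, besselY_natCast n hx, h3, pow_succ, pow_succ, h4, pow_succ]
    have := Real.pi_ne_zero
    field_simp
    linear_combination (-2 * besselJ (n + 1) x) * hsq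
  · have hs := sin_mul_pi_ne_zero h
    have h2 : ¬ ∃ n : ℤ, ν + 2 = n := by
      have := not_int_add_one (not_int_add_one h)
      rwa [add_assoc, one_add_one_eq_two] at this
    have h3 := besselJ_recurrence ν hx
    have h4 := besselJ_recurrence (-(ν + 2)) hx
    rw [e1, e2] at h4
    have e3 : (ν + 2) * Real.pi = ν * Real.pi + 2 * Real.pi := by ring
    rw [besselY_of_not_int h, besselY_of_not_int (not_int_add_one h), besselY_of_not_int h2, e3,
      add_mul ν 1, one_mul, Real.cos_add_pi, Real.sin_add_pi, Real.cos_add_two_pi,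
      Real.sin_add_two_pi, h3, h4]
    field_simp
    ring

/-! ### Behaviour near the origin -/

theorem tendsto_half_nhdsGT_zero : Tendsto (fun x : ℝ => x / 2) (𝓝[>] 0) (𝓝[>] 0) := by
  refine tendsto_nhdsWithin_iff.2 ⟨?_, ?_⟩
  · have : Continuous fun x : ℝ => x / 2 := by fun_prop
    have h := (this.tendsto 0).mono_left (nhdsWithin_le_nhds (s := Ioi 0))
    simpa using h
  · filter_upwards [self_mem_nhdsWithin] with x hx
    exact half_pos (mem_Ioi.1 hx)

theorem tendsto_half_rpow {r : ℝ} (hr : 0 < r) :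
    Tendsto (fun x : ℝ => (x / 2) ^ r) (𝓝[>] 0) (𝓝 0) := by
  have h := ((Real.continuousAt_rpow_const 0 r (Or.inr hr.le)).tendsto.mono_left
    (nhdsWithin_le_nhds (s := Ioi 0))).comp tendsto_half_nhdsGT_zero
  rwa [Real.zero_rpow hr.ne'] at h

theorem tendsto_log_half_mul_rpow {r : ℝ} (hr : 0 < r) :
    Tendsto (fun x : ℝ => Real.log (x / 2) * (x / 2) ^ r) (𝓝[>] 0) (𝓝 0) :=
  (tendsto_log_mul_rpow_nhdsGT_zero hr).comp tendsto_half_nhdsGT_zero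

theorem tendsto_rpow_mul_besselK {g : ℝ → ℝ} (hg : BddRight g) {ν : ℝ} (hν : 0 < ν) :
    Tendsto (fun x => (x / 2) ^ ν * besselK g ν x) (𝓝[>] 0) (𝓝 0) := by
  have h := (tendsto_half_rpow (add_pos hν hν)).mul (tendsto_besselSeries_sq hg ν)
  rw [zero_mul] at h
  refine h.congr' ?_
  filter_upwards [self_mem_nhdsWithin] with x hx
  have hx' : 0 < x / 2 := half_pos hx
  rw [besselK, Real.rpow_add hx', mul_assoc]

theorem tendsto_rpow_mul_log_mul_besselK {g : ℝ → ℝ} (hg : BddRight g) {ν : ℝ} (hν : 0 < ν) :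
    Tendsto (fun x => (x / 2) ^ ν * (Real.log (x / 2) * besselK g ν x)) (𝓝[>] 0) (𝓝 0) := by
  have h := (tendsto_log_half_mul_rpow (add_pos hν hν)).mul (tendsto_besselSeries_sq hg ν)
  rw [zero_mul] at h
  refine h.congr' ?_
  filter_upwards [self_mem_nhdsWithin] with x hx
  have hx' : 0 < x / 2 := half_pos hx
  rw [besselK, Real.rpow_add hx']
  ring

theorem tendsto_rpow_mul_besselK_neg {g : ℝ → ℝ} (hg : BddRight g) (ν : ℝ) :
    Tendsto (fun x => (x / 2) ^ ν * besselK g (-ν) x) (𝓝[>] 0) (𝓝 (g (-ν + 1))) := by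
  refine (tendsto_besselSeries_sq hg (-ν)).congr' ?_
  filter_upwards [self_mem_nhdsWithin] with x hx
  have hx' : 0 < x / 2 := half_pos hx
  rw [besselK, ← mul_assoc, ← Real.rpow_add hx', add_neg_cancel, Real.rpow_zero, one_mul]

theorem tendsto_rpow_mul_besselJ {ν : ℝ} (hν : 0 < ν) :
    Tendsto (fun x => (x / 2) ^ ν * besselJ ν x) (𝓝[>] 0) (𝓝 0) := by
  refine (tendsto_rpow_mul_besselK bddRight_rGamma hν).congr' ?_
  filter_upwards [self_mem_nhdsWithin] with x hx
  rw [besselJ_eq_besselK ν hx]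

/-- The `J_{-ν}` part dominates, or its order derivative if `ν` is an integer. Otherwise `L =
Γ(ν)/π` by the reflection formula; only `L > 0` matters later. -/
theorem tendsto_rpow_mul_besselY {ν : ℝ} (hν : 0 < ν) :
    ∃ L > 0, Tendsto (fun x => (x / 2) ^ ν * besselY ν x) (𝓝[>] 0) (𝓝 (-L)) := by
  by_cases h : ∃ n : ℤ, ν = n
  · obtain ⟨m, hm⟩ := exists_nat_eq_of_int hν h
    obtain ⟨n, hn⟩ : ∃ n : ℕ, n = m + 1 := ⟨_, rfl⟩
    obtain rfl : ν = n := by rw [hm, hn]; push_cast; ring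
    have hpos := neg_one_pow_mul_deriv_rGamma_neg m
    refine ⟨((-1) ^ m * deriv rGamma (-m)) / Real.pi, div_pos hpos Real.pi_pos, ?_⟩
    have h1 := tendsto_rpow_mul_log_mul_besselK bddRight_rGamma hν
    have h2 := tendsto_rpow_mul_besselK bddRight_deriv_rGamma hν
    have h3 := tendsto_rpow_mul_besselK_neg bddRight_deriv_rGamma n
    have h4 := (((h1.const_mul 2).add h2).add (h3.const_mul ((-1) ^ n))).div_const Real.pi
    have e : (2 * 0 + 0 + (-1) ^ n * deriv rGamma (-(n : ℝ) + 1)) / Real.pi =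
        -((-1) ^ m * deriv rGamma (-m) / Real.pi) := by
      have : -(n : ℝ) + 1 = -m := by rw [hn]; push_cast; ring
      rw [this, hn, pow_succ]
      ring
    rw [e] at h4
    refine h4.congr' ?_
    filter_upwards [self_mem_nhdsWithin] with x hx
    have hsq : ((-1) ^ n * (-1) ^ n : ℝ) = 1 := by rw [← mul_pow]; norm_num
    rw [besselY_natCast n hx, besselJOrderDeriv, besselJOrderDeriv, besselJ_neg_nat n hx,
      besselJ_eq_besselK n hx]
    linear_combination (-((x / 2) ^ (n : ℝ) * Real.log (x / 2) * besselK rGamma n x /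
      Real.pi)) * hsq
  · have hs := sin_mul_pi_ne_zero h
    refine ⟨Real.Gamma ν / Real.pi, div_pos (Real.Gamma_pos_of_pos hν) Real.pi_pos, ?_⟩
    have h1 := (((tendsto_rpow_mul_besselJ hν).const_mul (Real.cos (ν * Real.pi))).sub
      (tendsto_rpow_mul_besselK_neg bddRight_rGamma ν)).div_const (Real.sin (ν * Real.pi))
    have e : (Real.cos (ν * Real.pi) * 0 - rGamma (-ν + 1)) / Real.sin (ν * Real.pi) =
        -(Real.Gamma ν / Real.pi) := by
      have h2 := Real.Gamma_mul_Gamma_one_sub ν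
      rw [mul_comm Real.pi] at h2
      have h3 : Real.Gamma (1 - ν) ≠ 0 := by
        intro h0
        rw [h0, mul_zero] at h2
        exact div_ne_zero Real.pi_ne_zero hs h2.symm
      have e1 : -ν + 1 = 1 - ν := by ring
      have := Real.pi_ne_zero
      rw [e1, rGamma]
      field_simp at h2 ⊢
      linear_combination h2
    rw [e] at h1
    refine h1.congr' ?_
    filter_upwards [self_mem_nhdsWithin] with x hx
    rw [besselY_of_not_int h, ← besselJ_eq_besselK _ hx]
    ring

theorem eventually_besselJ_pos {ν : ℝ} (hν : 0 < ν) : ∀ᶠ x in 𝓝[>] (0 : ℝ), 0 < besselJ ν x := by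
  have hpos : 0 < rGamma (ν + 1) := inv_pos.2 (Real.Gamma_pos_of_pos (by positivity))
  filter_upwards [(tendsto_besselSeries_sq bddRight_rGamma ν).eventually_const_lt hpos,
    self_mem_nhdsWithin] with x h1 hx
  rw [besselJ_eq_besselK ν hx, besselK]
  exact mul_pos (Real.rpow_pos_of_pos (half_pos hx) _) h1

/-- The range of `α` enters here: either `α = 0` and only `J_ν` remains, or `sin α > 0` and `-sin α
Y_ν` dominates, tending to `+∞`. -/
theorem eventually_cylinderC_pos {α ν : ℝ} (hα₀ : 0 ≤ α) (hαπ : α < Real.pi) (hν : 0 < ν) :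
    ∀ᶠ x in 𝓝[>] (0 : ℝ), 0 < cylinderC α ν x := by
  rcases hα₀.eq_or_lt with rfl | hα
  · filter_upwards [eventually_besselJ_pos hν] with x hx
    simpa [cylinderC] using hx
  · have hsin : 0 < Real.sin α := Real.sin_pos_of_pos_of_lt_pi hα hαπ
    obtain ⟨L, hL, hY⟩ := tendsto_rpow_mul_besselY hν
    have h := ((tendsto_rpow_mul_besselJ hν).const_mul (Real.cos α)).sub
      (hY.const_mul (Real.sin α))
    have hlim : 0 < Real.cos α * 0 - Real.sin α * -L := by
      have := mul_pos hsin hL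
      linarith
    filter_upwards [h.eventually_const_lt hlim, self_mem_nhdsWithin] with x h1 hx
    have h2 : 0 < (x / 2) ^ ν * cylinderC α ν x := by
      rw [cylinderC]
      linarith
    exact pos_of_mul_pos_right h2 (Real.rpow_nonneg (half_pos hx).le _)

theorem isCylinderFamily_cylinderC {α : ℝ} (hα₀ : 0 ≤ α) (hαπ : α < Real.pi) :
    IsCylinderFamily (cylinderC α) := by
  have hup : ∀ {ν x : ℝ}, 0 < ν → 0 < x →
      HasDerivAt (cylinderC α ν) (ν / x * cylinderC α ν x - cylinderC α (ν + 1) x) x := by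
    intro ν x hν hx
    refine (((hasDerivAt_besselJ ν hx).const_mul (Real.cos α)).sub
      ((hasDerivAt_besselY hν hx).const_mul (Real.sin α))).congr_deriv ?_
    simp only [cylinderC]
    ring
  refine ⟨hup, fun {ν x} hν hx => ?_, fun hν => eventually_cylinderC_pos hα₀ hαπ hν⟩
  -- The downward rule is the upward rule at order `ν + 1` combined with the three-term recurrence.
  refine (hup (ν := ν + 1) (by positivity) hx).congr_deriv ?_
  have e : ν + 1 + 1 = ν + 2 := by ring
  simp only [cylinderC]
  rw [e, besselJ_recurrence ν hx, besselY_recurrence hν hx]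
  ring

end BesselInterlacing

theorem theorem4p1 (α ν : ℝ) (m : ℕ) (hα₀ : 0 ≤ α) (hαπ : α < Real.pi) (hν : 0 < ν)
    (hm : 1 ≤ m) (hM : BesselInterlacing.commonZeros α m ν = ∅) :
    ∃ c τ : ℕ → ℝ,
      BesselInterlacing.IsAscendingEnumeration
        (BesselInterlacing.positiveZeros (BesselInterlacing.cylinderC α ν)) c ∧
      BesselInterlacing.IsAscendingEnumeration
        (BesselInterlacing.positiveZeros (BesselInterlacing.cylinderC α (ν + m)) ∪
          BesselInterlacing.positiveZeros (BesselInterlacing.lommelR (m - 1) (ν + 1))) τ ∧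
      0 < c 0 ∧ ∀ k : ℕ, c k < τ k ∧ τ k < c (k + 1) := by
  obtain ⟨n, rfl⟩ := Nat.exists_eq_add_of_le' hm
  have e : ν + ((n + 1 : ℕ) : ℝ) = ν + n + 1 := by push_cast; ring
  have key := (BesselInterlacing.isCylinderFamily_cylinderC hα₀ hαπ).interlacing hν n
    fun x hx h0 h1 => by
      have : x ∈ BesselInterlacing.commonZeros α (n + 1) ν := ⟨⟨hx, h0⟩, by rw [e]; exact h1⟩
      rw [hM] at this
      exact this
  rw [e, Nat.add_sub_cancel]
  exact key
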